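/- **Theorem 1.1.** Let $S_i(x)=r_iR_i(x)+b_i$ ($1\le i\le m$) be contractive similitudes of $\mathbb{R}^d$, with $0<r_i<1$, $R_i$ orthogonal and $b_i\in\mathbb{R}^d$, let $K$ be the self-similar set they generate, i.e. the unique non-empty compact set with $K=\bigcup_{i=1}^m S_i(K)$, and assume the strong separation condition $S_i(K)\cap S_j(K)=\emptyset$ for $i\ne j$. Let $(p_1,\dots,p_m)$ be a probability vector ($p_i\ge 0$, $\sum_i p_i=1$) and let $\mu$ be the corresponding self-similar measure, i.e. the unique Borel probability measure on $\mathbb{R}^d$ with $\mu=\sum_{i=1}^m p_i\,\mu\circ S_i^{-1}$. Let $s$ be the Hausdorff dimension of $K$. The basic cubes are the sets $K_{i_1\cdots i_n}=S_{i_1}\circ\cdots\circ S_{i_n}(K)$, $n\ge 0$ (with $K$ itself for $n=0$); $\mathcal{D}$ denotes the family of all of them. For $0<\alpha\le s$ with $s>0$ and $E\subset K$ put $$H^\alpha_\mu(E)=\inf\Big\{\sum_j\mu(I_j)^{\alpha/s}:\ E\subset\bigcup_j I_j,\ I_j\in\mathcal{D}\Big\},$$ the infimum being over finite or countable covers, and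 for $0<p<\infty$ and $g:K\to[0,\infty]$ put $$\int_K g^p\,dH^\alpha_\mu = p\int_0^\infty t^{p-1}H^\alpha_\mu(\{x\in K: g(x)>t\})\,dt.$$ For a $\mu$-measurable $f:K\to\mathbb{R}$ and $x\in K$ put $$M^\mu_{\mathcal{D}}f(x)=\sup_{I\in\mathcal{D},\,x\in I}\frac1{\mu(I)}\int_I|f|\,d\mu\in[0,\infty],$$ where the quotient is read as $0$ if $\mu(I)=0$ (by strong separation, $x$ lies in exactly one cube $K_{i_1\cdots i_n}$ for each $n$). Let $0<\alpha<s$ and $\alpha/s<p<\infty$. Then for every $\mu$-measurable $f:K\to\mathbb{R}$ with $\int_K|f|^p\,dH^\alpha_\mu<\infty$, $$\int_K \big(M^\mu_{\mathcal{D}}f\big)^p\,dH^\alpha_\mu\le C_{p,\alpha,s}\int_K|f|^p\,dH^\alpha_\mu,$$ where $$C_{p,\alpha,s}=\begin{cases}\dfrac{2^{p+2}}{p-\alpha/s}, & \alpha/s<p<1,\\[2mm] \dfrac{2^{2p+1}}{p(1-\alpha/s)}, & 1\le p<\infty.\end{cases}$$ -/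

import Mathlib

open MeasureTheory Set
open scoped ENNReal

noncomputable section

/-- An iterated function system of `m` contractive similitudes
`S_i(x) = r_i R_i(x) + b_i` of `ℝ^d`, with `0 < r_i < 1` and `R_i` orthogonal. -/
structure SimilitudeIFS (d m : ℕ) where
  ratio : Fin m → ℝ
  rot : Fin m → (EuclideanSpace ℝ (Fin d) ≃ₗᵢ[ℝ] EuclideanSpace ℝ (Fin d))
  shift : Fin m → EuclideanSpace ℝ (Fin d)
  ratio_pos : ∀ i, 0 < ratio i
  ratio_lt_one : ∀ i, ratio i < 1

namespace SimilitudeIFS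

variable {d m : ℕ}

/-- The similitude `S_i`. -/
def map (S : SimilitudeIFS d m) (i : Fin m) (x : EuclideanSpace ℝ (Fin d)) :
    EuclideanSpace ℝ (Fin d) :=
  S.ratio i • S.rot i x + S.shift i

/-- `K` is the self-similar set generated by `S`: the (unique) non-empty compact set with
`K = ⋃ i, S_i(K)`. -/
def IsSelfSimilarSet (S : SimilitudeIFS d m) (K : Set (EuclideanSpace ℝ (Fin d))) : Prop :=
  K.Nonempty ∧ IsCompact K ∧ K = ⋃ i, S.map i '' K

/-- The strong separation condition: the first-level pieces of `K` are pairwise disjoint. -/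
def StrongSeparation (S : SimilitudeIFS d m) (K : Set (EuclideanSpace ℝ (Fin d))) : Prop :=
  ∀ i j, i ≠ j → Disjoint (S.map i '' K) (S.map j '' K)

/-- `μ` is the self-similar measure of `S` with probability vector `w`: the (unique) Borel
probability measure on `ℝ^d` with `μ = ∑ i, w_i • (μ ∘ S_i⁻¹)`. -/
def IsSelfSimilarMeasure (S : SimilitudeIFS d m) (w : Fin m → ℝ)
    (μ : Measure (EuclideanSpace ℝ (Fin d))) : Prop :=
  IsProbabilityMeasure μ ∧ μ = ∑ i, ENNReal.ofReal (w i) • μ.map (S.map i)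

/-- For a finite word `i₁ i₂ … i_n`, the composition `S_{i₁} ∘ S_{i₂} ∘ ⋯ ∘ S_{i_n}`
(the identity for the empty word). -/
def wordMap (S : SimilitudeIFS d m) :
    List (Fin m) → EuclideanSpace ℝ (Fin d) → EuclideanSpace ℝ (Fin d)
  | [] => id
  | i :: v => S.map i ∘ S.wordMap v

/-- The basic cube `K_v = S_v(K)` of the word `v`; the empty word gives `K` itself. -/
def cube (S : SimilitudeIFS d m) (K : Set (EuclideanSpace ℝ (Fin d))) (v : List (Fin m)) :
    Set (EuclideanSpace ℝ (Fin d)) :=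
  S.wordMap v '' K

/-- The Hardy–Littlewood maximal function over basic cubes: the supremum of the averages
of `|f|` over all basic cubes containing `x` (for `x ∈ K`, under strong separation, there is
exactly one of each level `n = 0, 1, 2, …`). It takes values in `[0, ∞]`, and the average over
a basic cube of measure zero is `0 / 0 = 0`. -/
def maximalFunction (S : SimilitudeIFS d m) (K : Set (EuclideanSpace ℝ (Fin d)))
    (μ : Measure (EuclideanSpace ℝ (Fin d))) (f : EuclideanSpace ℝ (Fin d) → ℝ)
    (x : EuclideanSpace ℝ (Fin d)) : ℝ≥0∞ :=
  ⨆ (v : List (Fin m)) (_ : x ∈ S.cube K v),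
    (∫⁻ y in S.cube K v, ENNReal.ofReal |f y| ∂μ) / μ (S.cube K v)

/-- The `α`-dimensional Hausdorff content `H^α_μ(E)`, where `s` is the dimension of `K`: the
infimum of `∑ μ(I)^(α/s)` over all finite or countable covers of `E` by basic cubes (there are
only countably many basic cubes). -/
def content (S : SimilitudeIFS d m) (K : Set (EuclideanSpace ℝ (Fin d)))
    (μ : Measure (EuclideanSpace ℝ (Fin d))) (α s : ℝ) (E : Set (EuclideanSpace ℝ (Fin d))) :
    ℝ≥0∞ :=
  ⨅ (W : Set (List (Fin m))) (_ : E ⊆ ⋃ v ∈ W, S.cube K v),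
    ∑' v : W, μ (S.cube K (v : List (Fin m))) ^ (α / s)

/-- The `p`-Choquet integral `∫_K g^p dH^α_μ = p ∫_0^∞ t^(p-1) H^α_μ({x ∈ K : g x > t}) dt` of
`g ≥ 0`. -/
def choquetPow (S : SimilitudeIFS d m) (K : Set (EuclideanSpace ℝ (Fin d)))
    (μ : Measure (EuclideanSpace ℝ (Fin d))) (α s p : ℝ)
    (g : EuclideanSpace ℝ (Fin d) → ℝ≥0∞) : ℝ≥0∞ :=
  ENNReal.ofReal p * ∫⁻ t in Ioi (0 : ℝ),
    ENNReal.ofReal (t ^ (p - 1)) * S.content K μ α s {x ∈ K | ENNReal.ofReal t < g x}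

end SimilitudeIFS

/-- The constant `C_{p,α,s}`. -/
def strongTypeConst (p α s : ℝ) : ℝ :=
  if p < 1 then 2 ^ (p + 2) / (p - α / s) else 2 ^ (2 * p + 1) / (p * (1 - α / s))

end

namespace SimilitudeIFS

variable {d m : ℕ} {S : SimilitudeIFS d m} {K : Set (EuclideanSpace ℝ (Fin d))}

/-! Write θ = α/s. By strong separation the basic cubes form a tree: two of them are nested or
disjoint. This makes the Choquet integral tractable: if g ≤ Σ c_w 1_{K_w} on K, its integral is at
most the cost Σ c_w μ(K_w)^θ (`lintegral_content_le_tsum`). For a single cube, (M 1_{K_v})^p lies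
below such a combination, of cost at most p/(p-θ) μ(K_v)^θ (`exists_weights_cube`).

For p ≤ 1, |f| is dominated on K by the sum over k of 2^(k+1) times the indicators of a near-optimal
cover of {|f| > 2^k}. Sublinearity of M and subadditivity of the p-th power add up the single-cube
bounds, and the resulting geometric sum of contents is compared with the integral. For p ≥ 1, Jensen
gives (Mf)^p ≤ M(|f|^p), and the case of exponent 1 is applied to |f|^p. -/

/-! ### The tree of basic cubes. -/

theorem continuous_map (S : SimilitudeIFS d m) (i : Fin m) : Continuous (S.map i) := by
  unfold SimilitudeIFS.map
  have := (S.rot i).continuous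
  fun_prop

theorem injective_map (S : SimilitudeIFS d m) (i : Fin m) : Function.Injective (S.map i) := by
  intro x y h
  have h' : S.ratio i • S.rot i x = S.ratio i • S.rot i y := by
    simpa [SimilitudeIFS.map] using h
  exact (S.rot i).injective (smul_right_injective _ (S.ratio_pos i).ne' h')

theorem continuous_wordMap (S : SimilitudeIFS d m) (v : List (Fin m)) :
    Continuous (S.wordMap v) := by
  induction v with
  | nil => exact continuous_id
  | cons i v ih => exact (S.continuous_map i).comp ih

theorem measurableSet_cube (hK : S.IsSelfSimilarSet K) (v : List (Fin m)) :
    MeasurableSet (S.cube K v) :=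
  (hK.2.1.image (S.continuous_wordMap v)).isClosed.measurableSet

theorem cube_nil : S.cube K [] = K := image_id K

theorem cube_cons (i : Fin m) (v : List (Fin m)) :
    S.cube K (i :: v) = S.map i '' S.cube K v := image_comp _ _ _

theorem map_image_subset (hK : S.IsSelfSimilarSet K) (i : Fin m) : S.map i '' K ⊆ K := by
  conv_rhs => rw [hK.2.2]
  exact subset_iUnion (fun i => S.map i '' K) i

theorem cube_subset (hK : S.IsSelfSimilarSet K) (v : List (Fin m)) : S.cube K v ⊆ K := by
  induction v with
  | nil => exact cube_nil.subset
  | cons i v ih => rw [cube_cons]; exact (image_mono ih).trans (map_image_subset hK i)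

theorem cube_subset_of_prefix (hK : S.IsSelfSimilarSet K) {u v : List (Fin m)} (h : u <+: v) :
    S.cube K v ⊆ S.cube K u := by
  induction u generalizing v with
  | nil => rw [cube_nil]; exact cube_subset hK v
  | cons i u ih =>
    obtain ⟨v', rfl, h'⟩ := List.cons_prefix_iff.1 h
    rw [cube_cons, cube_cons]
    exact image_mono (ih h')

/-- Separation is assumed only at the first level; injectivity of the similitudes carries it to all
deeper levels. -/
theorem prefix_or_prefix_of_mem_cube (hK : S.IsSelfSimilarSet K) (hsep : S.StrongSeparation K)
    {u v : List (Fin m)} {x : EuclideanSpace ℝ (Fin d)} (hu : x ∈ S.cube K u)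
    (hv : x ∈ S.cube K v) : u <+: v ∨ v <+: u := by
  induction u generalizing v x with
  | nil => exact Or.inl List.nil_prefix
  | cons i u ih =>
    cases v with
    | nil => exact Or.inr List.nil_prefix
    | cons j v =>
      rw [cube_cons] at hu hv
      obtain ⟨y, hy, rfl⟩ := hu
      obtain ⟨z, hz, hzy⟩ := hv
      obtain rfl : i = j := by
        by_contra hij
        exact (hsep i j hij).le_bot ⟨mem_image_of_mem _ (cube_subset hK u hy),
          hzy ▸ mem_image_of_mem _ (cube_subset hK v hz)⟩
      obtain rfl := S.injective_map i hzy
      simpa only [List.prefix_cons_inj] using ih hy hz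

/-! ### Choquet integrals of combinations of cube indicators. -/

/-- The cubes containing x form a chain, so the weights can be added from the root downwards; v is
the cube at which the running sum first exceeds t. -/
theorem exists_prefix_first_passage (hK : S.IsSelfSimilarSet K) (hsep : S.StrongSeparation K)
    (c : List (Fin m) → ℝ≥0∞) {x : EuclideanSpace ℝ (Fin d)} {t : ℝ≥0∞}
    (h : t < ∑' w, c w * (S.cube K w).indicator 1 x) :
    ∃ v, x ∈ S.cube K v ∧ ∑ j ∈ Finset.range v.length, c (v.take j) ≤ t ∧
      t < ∑ j ∈ Finset.range v.length, c (v.take j) + c v := by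
  classical
  rw [ENNReal.tsum_eq_iSup_sum, lt_iSup_iff] at h
  obtain ⟨F, hF⟩ := h
  set F' := F.filter (fun w => x ∈ S.cube K w) with hF'
  have hsum : ∑ w ∈ F, c w * (S.cube K w).indicator 1 x = ∑ w ∈ F', c w := by
    rw [hF', Finset.sum_filter]
    refine Finset.sum_congr rfl fun w _ => ?_
    by_cases hw : x ∈ S.cube K w <;> simp [hw]
  rw [hsum] at hF
  have hne : F'.Nonempty := by
    rw [Finset.nonempty_iff_ne_empty]
    intro h0
    simp [h0] at hF
  -- A finite subsum already exceeds t; the longest word in it has all the others as prefixes.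
  obtain ⟨v, hvF, hvmax⟩ := F'.exists_max_image List.length hne
  have hxv : x ∈ S.cube K v := (Finset.mem_filter.1 hvF).2
  have hpre : ∀ w ∈ F', w <+: v := by
    intro w hw
    rcases prefix_or_prefix_of_mem_cube hK hsep (Finset.mem_filter.1 hw).2 hxv with h | h
    · exact h
    · rw [h.eq_of_length (le_antisymm h.length_le (hvmax w hw))]
  have hlarge : t < ∑ j ∈ Finset.range (v.length + 1), c (v.take j) := by
    refine hF.trans_le ?_
    have hinj : Set.InjOn (fun j => v.take j) (Finset.range (v.length + 1)) := by
      intro a ha b hb hab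
      have := congrArg List.length hab
      simp only [List.length_take] at this
      simp only [Finset.coe_range, mem_Iio] at ha hb
      omega
    rw [← Finset.sum_image (f := c) hinj]
    refine Finset.sum_le_sum_of_subset fun w hw => Finset.mem_image.2 ⟨w.length, ?_, ?_⟩
    · have := (hpre w hw).length_le
      simp only [Finset.mem_range]
      omega
    · exact (List.prefix_iff_eq_take.1 (hpre w hw)).symm
  -- The prefix of length l is the last term of the sum over `range (l + 1)`, so minimality of l
  -- bounds the sum over its proper prefixes by t.
  have hex : ∃ l, t < ∑ j ∈ Finset.range (l + 1), c (v.take j) := ⟨_, hlarge⟩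
  have hl : Nat.find hex ≤ v.length := Nat.find_min' hex hlarge
  set l := Nat.find hex with hldef
  have hlen : (v.take l).length = l := by simpa using hl
  have htake : ∑ j ∈ Finset.range l, c ((v.take l).take j) =
      ∑ j ∈ Finset.range l, c (v.take j) := by
    refine Finset.sum_congr rfl fun j hj => ?_
    rw [List.take_take, min_eq_left (Finset.mem_range.1 hj).le]
  refine ⟨v.take l, cube_subset_of_prefix hK (List.take_prefix l v) hxv, ?_, ?_⟩
  · rw [hlen, htake]
    rcases Nat.eq_zero_or_pos l with h0 | hpos
    · simp [h0]
    · have := Nat.find_min hex (m := l - 1) (by omega)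
      rw [Nat.sub_add_cancel hpos] at this
      exact not_lt.1 this
  · rw [hlen, htake, ← Finset.sum_range_succ (fun j => c (v.take j))]
    exact Nat.find_spec hex

theorem lintegral_indicator_ofReal_mem_Ico_le (a b q : ℝ≥0∞) :
    ∫⁻ t in Ioi (0 : ℝ), {t : ℝ | a ≤ ENNReal.ofReal t ∧ ENNReal.ofReal t < a + b}.indicator
      (fun _ => q) t ≤ b * q := by
  have hm : MeasurableSet {t : ℝ | a ≤ ENNReal.ofReal t ∧ ENNReal.ofReal t < a + b} :=
    (measurableSet_le measurable_const ENNReal.measurable_ofReal).inter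
      (measurableSet_lt ENNReal.measurable_ofReal measurable_const)
  rw [lintegral_indicator_const hm, mul_comm, Measure.restrict_apply hm]
  gcongr
  rcases eq_or_ne a ∞ with rfl | ha
  · simp
  rcases eq_or_ne b ∞ with rfl | hb
  · simp
  lift a to NNReal using ha
  lift b to NNReal using hb
  refine (measure_mono (t := Ico (a : ℝ) (a + b)) ?_).trans (by simp)
  rintro t ⟨⟨h1, h2⟩, ht : 0 < t⟩
  constructor
  · rwa [← ENNReal.ofReal_coe_nnreal, ENNReal.ofReal_le_ofReal_iff ht.le] at h1
  · rw [← ENNReal.coe_add, ENNReal.ofReal_lt_coe_iff ht.le] at h2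
    simpa using h2

/-- The first-passage cubes at height t cover the level set, and v is one of them only for t in an
interval of length c v. Integrating in t charges μ(K_v)^θ exactly that length. -/
theorem lintegral_content_le_tsum (hK : S.IsSelfSimilarSet K) (hsep : S.StrongSeparation K)
    (μ : Measure (EuclideanSpace ℝ (Fin d))) (α s : ℝ)
    (c : List (Fin m) → ℝ≥0∞) (g : EuclideanSpace ℝ (Fin d) → ℝ≥0∞)
    (hg : ∀ x ∈ K, g x ≤ ∑' w, c w * (S.cube K w).indicator 1 x) :
    ∫⁻ t in Ioi (0 : ℝ), S.content K μ α s {x ∈ K | ENNReal.ofReal t < g x} ≤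
      ∑' w, c w * μ (S.cube K w) ^ (α / s) := by
  set P : List (Fin m) → ℝ≥0∞ := fun v => ∑ j ∈ Finset.range v.length, c (v.take j) with hP
  set A : List (Fin m) → Set ℝ := fun v =>
    {t : ℝ | P v ≤ ENNReal.ofReal t ∧ ENNReal.ofReal t < P v + c v} with hA
  have hAm : ∀ v, MeasurableSet (A v) := fun v =>
    (measurableSet_le measurable_const ENNReal.measurable_ofReal).inter
      (measurableSet_lt ENNReal.measurable_ofReal measurable_const)
  calc ∫⁻ t in Ioi (0 : ℝ), S.content K μ α s {x ∈ K | ENNReal.ofReal t < g x}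
      ≤ ∫⁻ t in Ioi (0 : ℝ), ∑' v, (A v).indicator (fun _ => μ (S.cube K v) ^ (α / s)) t := by
        refine lintegral_mono fun t => ?_
        refine (iInf₂_le {v | t ∈ A v} ?_).trans (le_of_eq ?_)
        · rintro x ⟨hx, hxt⟩
          obtain ⟨v, hv, h1, h2⟩ :=
            exists_prefix_first_passage hK hsep c (hxt.trans_le (hg x hx))
          exact mem_biUnion (x := v) ⟨h1, h2⟩ hv
        · rw [tsum_subtype {v | t ∈ A v} (fun v => μ (S.cube K v) ^ (α / s))]
          rfl
    _ = ∑' v, ∫⁻ t in Ioi (0 : ℝ), (A v).indicator (fun _ => μ (S.cube K v) ^ (α / s)) t :=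
        lintegral_tsum fun v => (measurable_const.indicator (hAm v)).aemeasurable
    _ ≤ ∑' w, c w * μ (S.cube K w) ^ (α / s) :=
        ENNReal.tsum_le_tsum fun v => lintegral_indicator_ofReal_mem_Ico_le _ _ _

/-! ### The maximal function of a single cube. -/

/-- One step of the cost recursion from a cube of measure q to a child of measure ρq. After division
by (ρq)^θ it is a weighted AM-GM inequality for ρ^p and 1; p/(p-θ) is the limit of
(1-ρ^p)/(1-ρ^(p-θ)) as ρ → 1. -/
theorem rpow_mul_add_one_sub_rpow_mul_le {θ p ρ q : ℝ} (hθ : 0 < θ) (hp : θ < p)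
    (hρ0 : 0 < ρ) (hq : 0 < q) :
    ρ ^ p * (p / (p - θ) * q ^ θ) + (1 - ρ ^ p) * (ρ * q) ^ θ ≤ p / (p - θ) * (ρ * q) ^ θ := by
  have hp0 : 0 < p := hθ.trans hp
  have hpθ : 0 < p - θ := sub_pos.2 hp
  have hag := Real.geom_mean_le_arith_mean2_weighted (w₁ := (p - θ) / p) (w₂ := θ / p)
    (p₁ := ρ ^ p) (p₂ := 1) (by positivity) (by positivity) (by positivity) zero_le_one
    (by field_simp; ring)
  rw [← Real.rpow_mul hρ0.le, Real.one_rpow, mul_one, mul_one, mul_div_cancel₀ _ hp0.ne'] at hag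
  have hsplit : ρ ^ p = ρ ^ (p - θ) * ρ ^ θ := by
    rw [← Real.rpow_add hρ0]; ring_nf
  rw [Real.mul_rpow hρ0.le hq.le]
  have key : p / (p - θ) * ρ ^ (p - θ) + (1 - ρ ^ p) ≤ p / (p - θ) := by
    have h := mul_le_mul_of_nonneg_left hag (div_pos hp0 hpθ).le
    have e : p / (p - θ) * ((p - θ) / p * ρ ^ p + θ / p) = ρ ^ p + (p / (p - θ) - 1) := by
      field_simp; ring
    linarith
  calc ρ ^ p * (p / (p - θ) * q ^ θ) + (1 - ρ ^ p) * (ρ ^ θ * q ^ θ)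
      = (p / (p - θ) * ρ ^ (p - θ) + (1 - ρ ^ p)) * (ρ ^ θ * q ^ θ) := by
        rw [add_mul]; congr 1; rw [hsplit]; ring
    _ ≤ _ := by gcongr

theorem ennreal_rpow_mul_add_one_sub_rpow_mul_le {θ p : ℝ} {a b : ℝ≥0∞} (hθ : 0 < θ) (hp : θ < p)
    (hab : a ≤ b) (ha : a ≠ 0) (hb : b ≠ ∞) :
    (a / b) ^ p * (ENNReal.ofReal (p / (p - θ)) * b ^ θ) + (1 - (a / b) ^ p) * a ^ θ ≤
      ENNReal.ofReal (p / (p - θ)) * a ^ θ := by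
  have hp0 : 0 < p := hθ.trans hp
  have hpθ : 0 < p - θ := sub_pos.2 hp
  have ha' : a ≠ ∞ := ne_top_of_le_ne_top hb hab
  have hb0 : b ≠ 0 := fun h => ha (le_zero_iff.1 (h ▸ hab))
  have hA := ENNReal.toReal_pos ha ha'
  have hB := ENNReal.toReal_pos hb0 hb
  have hAB : a.toReal ≤ b.toReal := ENNReal.toReal_mono hb hab
  rw [← ENNReal.ofReal_toReal ha', ← ENNReal.ofReal_toReal hb]
  generalize a.toReal = A at *
  generalize b.toReal = B at *
  have h := rpow_mul_add_one_sub_rpow_mul_le hθ hp (div_pos hA hB) hB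
  rw [div_mul_cancel₀ _ hB.ne'] at h
  have h1 : 0 ≤ 1 - (A / B) ^ p :=
    sub_nonneg.2 (Real.rpow_le_one (by positivity) (by rwa [div_le_one hB]) hp0.le)
  rw [← ENNReal.ofReal_div_of_pos hB, ENNReal.ofReal_rpow_of_pos (div_pos hA hB),
    ENNReal.ofReal_rpow_of_pos hA, ENNReal.ofReal_rpow_of_pos hB, ← ENNReal.ofReal_one,
    ← ENNReal.ofReal_sub _ (by positivity), ← ENNReal.ofReal_mul (by positivity),
    ← ENNReal.ofReal_mul (by positivity), ← ENNReal.ofReal_mul h1,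
    ← ENNReal.ofReal_mul (by positivity), ← ENNReal.ofReal_add (by positivity) (by positivity)]
  exact ENNReal.ofReal_le_ofReal h

/-- The `p`-th power of the maximal function of the indicator of one cube is dominated by a
combination of indicators of the cubes that contain it, at a controlled cost. -/
theorem exists_weights_cube (hK : S.IsSelfSimilarSet K) (hsep : S.StrongSeparation K)
    (μ : Measure (EuclideanSpace ℝ (Fin d))) [IsFiniteMeasure μ] {θ p : ℝ} (hθ : 0 < θ)
    (hp : θ < p) (v : List (Fin m)) :
    ∃ a : List (Fin m) → ℝ≥0∞,
      (∀ x u, x ∈ S.cube K u → (μ (S.cube K v ∩ S.cube K u) / μ (S.cube K u)) ^ p ≤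
        ∑' w, a w * (S.cube K w).indicator 1 x) ∧
      ∑' w, a w * μ (S.cube K w) ^ θ ≤
        ENNReal.ofReal (p / (p - θ)) * μ (S.cube K v) ^ θ := by
  classical
  have hp0 : 0 < p := hθ.trans hp
  have hC : 1 ≤ p / (p - θ) := by rw [one_le_div (sub_pos.2 hp)]; linarith
  have hle1 : ∀ v u : List (Fin m),
      (μ (S.cube K v ∩ S.cube K u) / μ (S.cube K u)) ^ p ≤ 1 := fun v u =>
    ENNReal.rpow_le_one (ENNReal.div_le_of_le_mul (by
      rw [one_mul]; exact measure_mono inter_subset_right)) hp0.le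
  -- The parent cube is obtained by dropping the last letter.
  induction v using List.reverseRecOn with
  | nil =>
    refine ⟨Pi.single [] 1, fun x u hx => (hle1 _ _).trans ?_, ?_⟩
    · rw [tsum_eq_single []]
      · simp [cube_nil, cube_subset hK u hx]
      · intro w hw; simp [Pi.single_eq_of_ne hw]
    · rw [tsum_eq_single []]
      · rw [Pi.single_eq_same]
        gcongr
        exact ENNReal.one_le_ofReal.2 hC
      · intro w hw; simp [Pi.single_eq_of_ne hw]
  | append_singleton v i ih =>
    obtain ⟨a, ha1, ha2⟩ := ih
    rcases eq_or_ne (μ (S.cube K (v ++ [i]))) 0 with h0 | h0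
    · refine ⟨0, fun x u hx => ?_, by simp⟩
      rw [measure_mono_null inter_subset_left h0]
      simp [hp0]
    have hsub : S.cube K (v ++ [i]) ⊆ S.cube K v :=
      cube_subset_of_prefix hK (List.prefix_append _ _)
    have hle := measure_mono (μ := μ) hsub
    have hv0 : μ (S.cube K v) ≠ 0 := fun h => h0 (le_zero_iff.1 (h ▸ hle))
    set ρ := μ (S.cube K (v ++ [i])) / μ (S.cube K v) with hρ
    have hρ1 : ρ ^ p ≤ 1 :=
      ENNReal.rpow_le_one (ENNReal.div_le_of_le_mul (by rwa [one_mul])) hp0.le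
    have htsum : ∀ F : List (Fin m) → ℝ≥0∞,
        ∑' w, (ρ ^ p * a w + Pi.single (M := fun _ => ℝ≥0∞) (v ++ [i]) (1 - ρ ^ p) w) * F w =
          ρ ^ p * ∑' w, a w * F w + (1 - ρ ^ p) * F (v ++ [i]) := by
      intro F
      simp_rw [add_mul, mul_assoc]
      rw [ENNReal.tsum_add, ENNReal.tsum_mul_left]
      congr 1
      rw [tsum_eq_single (v ++ [i])]
      · rw [Pi.single_eq_same]
      · intro w hw; simp [Pi.single_eq_of_ne hw]
    -- Passing from K_v to its child multiplies averages over cubes containing K_v by ρ. On the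
    -- child itself the inherited weights give at least ρ^p, and 1 - ρ^p tops this up to 1.
    refine ⟨fun w => ρ ^ p * a w + Pi.single (M := fun _ => ℝ≥0∞) (v ++ [i]) (1 - ρ ^ p) w, fun x u hx => ?_, ?_⟩
    · rw [htsum]
      rcases (S.cube K (v ++ [i]) ∩ S.cube K u).eq_empty_or_nonempty with he | ⟨y, hy1, hy2⟩
      · rw [he]; simp [hp0]
      rcases eq_or_ne (μ (S.cube K u)) 0 with hu0 | hu0
      · rw [measure_mono_null inter_subset_right hu0]; simp [hp0]
      rcases prefix_or_prefix_of_mem_cube hK hsep hy1 hy2 with h | h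
      · have hxv : x ∈ S.cube K (v ++ [i]) := cube_subset_of_prefix hK h hx
        have h1 := ha1 x u hx
        rw [inter_eq_self_of_subset_right ((cube_subset_of_prefix hK h).trans hsub),
          ENNReal.div_self hu0 (measure_ne_top _ _), ENNReal.one_rpow] at h1
        calc _ ≤ 1 := hle1 _ _
          _ = ρ ^ p * 1 + (1 - ρ ^ p) * 1 := by
            rw [mul_one, mul_one, add_tsub_cancel_of_le hρ1]
          _ ≤ _ := by
            gcongr
            simp [hxv]
      · rcases List.prefix_concat_iff.1 h with rfl | h
        · have h1 := ha1 x _ hx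
          have hv : S.cube K v ∩ S.cube K (v ++ [i]) = S.cube K (v ++ [i]) :=
            inter_eq_self_of_subset_right hsub
          rw [hv, ENNReal.div_self hu0 (measure_ne_top _ _), ENNReal.one_rpow] at h1
          calc _ ≤ 1 := hle1 _ _
            _ = ρ ^ p * 1 + (1 - ρ ^ p) * 1 := by
              rw [mul_one, mul_one, add_tsub_cancel_of_le hρ1]
            _ ≤ _ := by
              gcongr
              simp [hx]
        · have h1 := ha1 x u hx
          have hvu := cube_subset_of_prefix hK h
          rw [inter_eq_self_of_subset_left hvu] at h1
          rw [inter_eq_self_of_subset_left (hsub.trans hvu)]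
          calc (μ (S.cube K (v ++ [i])) / μ (S.cube K u)) ^ p
              = ρ ^ p * (μ (S.cube K v) / μ (S.cube K u)) ^ p := by
                rw [← ENNReal.mul_rpow_of_nonneg _ _ hp0.le, hρ, ← mul_div_assoc,
                  ENNReal.div_mul_cancel hv0 (measure_ne_top _ _)]
            _ ≤ ρ ^ p * ∑' w, a w * (S.cube K w).indicator 1 x := by gcongr
            _ ≤ _ := le_self_add
    · rw [htsum]
      refine le_trans ?_ (ennreal_rpow_mul_add_one_sub_rpow_mul_le hθ hp hle h0
        (measure_ne_top _ _))
      gcongr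

/-! ### Subadditivity of powers, near-optimal covers and discretised integrals. -/

theorem _root_.ENNReal.tsum_rpow_le_tsum {ι : Type*} (f : ι → ℝ≥0∞) {p : ℝ} (hp0 : 0 < p)
    (hp1 : p ≤ 1) : (∑' i, f i) ^ p ≤ ∑' i, f i ^ p := by
  classical
  have hfin : ∀ s : Finset ι, (∑ i ∈ s, f i) ^ p ≤ ∑ i ∈ s, f i ^ p := by
    intro s
    induction s using Finset.induction_on with
    | empty => simp [hp0]
    | insert i s hi ih =>
      rw [Finset.sum_insert hi, Finset.sum_insert hi]
      exact (ENNReal.rpow_add_le_add_rpow _ _ hp0.le hp1).trans (by gcongr)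
  rw [← ENNReal.le_rpow_inv_iff hp0, ENNReal.tsum_eq_iSup_sum]
  refine iSup_le fun s => ?_
  rw [ENNReal.le_rpow_inv_iff hp0]
  exact (hfin s).trans (ENNReal.sum_le_tsum s)

/-- The maximal function over basic cubes of a function with values in `[0, ∞]`. -/
noncomputable def emaximalFunction (S : SimilitudeIFS d m) (K : Set (EuclideanSpace ℝ (Fin d)))
    (μ : Measure (EuclideanSpace ℝ (Fin d))) (g : EuclideanSpace ℝ (Fin d) → ℝ≥0∞)
    (x : EuclideanSpace ℝ (Fin d)) : ℝ≥0∞ :=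
  ⨆ (v : List (Fin m)) (_ : x ∈ S.cube K v), (∫⁻ y in S.cube K v, g y ∂μ) / μ (S.cube K v)

theorem content_mono (μ : Measure (EuclideanSpace ℝ (Fin d))) (α s : ℝ)
    {E F : Set (EuclideanSpace ℝ (Fin d))} (h : E ⊆ F) :
    S.content K μ α s E ≤ S.content K μ α s F :=
  le_iInf₂ fun W hW => iInf₂_le W (h.trans hW)

theorem content_lt_top (μ : Measure (EuclideanSpace ℝ (Fin d))) [IsFiniteMeasure μ] {α s : ℝ}
    (hθ : 0 < α / s) {E : Set (EuclideanSpace ℝ (Fin d))} (hE : E ⊆ K) :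
    S.content K μ α s E < ∞ := by
  refine (iInf₂_le {[]} ?_).trans_lt
    (b := ∑' v : ({[]} : Set (List (Fin m))), μ (S.cube K (v : List (Fin m))) ^ (α / s)) ?_
  · simpa [cube_nil] using hE
  · rw [tsum_singleton [] (fun v => μ (S.cube K v) ^ (α / s))]
    exact ENNReal.rpow_lt_top_of_nonneg hθ.le (measure_ne_top _ _)

theorem exists_cover_le_content_add (μ : Measure (EuclideanSpace ℝ (Fin d))) [IsFiniteMeasure μ]
    {α s : ℝ} (hθ : 0 < α / s) {E : Set (EuclideanSpace ℝ (Fin d))} (hE : E ⊆ K) {δ : ℝ≥0∞}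
    (hδ : δ ≠ 0) :
    ∃ W : Set (List (Fin m)), E ⊆ ⋃ v ∈ W, S.cube K v ∧
      ∑' v : W, μ (S.cube K (v : List (Fin m))) ^ (α / s) ≤ S.content K μ α s E + δ := by
  have h := ENNReal.lt_add_right (content_lt_top (S := S) μ hθ hE).ne hδ
  conv_lhs at h => unfold SimilitudeIFS.content
  obtain ⟨W, hW⟩ := iInf_lt_iff.1 h
  obtain ⟨hEW, hlt⟩ := iInf_lt_iff.1 hW
  exact ⟨W, hEW, hlt.le⟩

/-- A lower Riemann sum: the content of the level set decreases in t, so on (l^(k-1), l^k] it is at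
least its value at l^k. -/
theorem tsum_zpow_content_le (μ : Measure (EuclideanSpace ℝ (Fin d))) (α s : ℝ)
    (g : EuclideanSpace ℝ (Fin d) → ℝ≥0∞) {l : ℝ} (hl : 1 < l) :
    ∑' k : ℤ, ENNReal.ofReal (l ^ k - l ^ (k - 1)) *
        S.content K μ α s {x ∈ K | ENNReal.ofReal (l ^ k) < g x} ≤
      ∫⁻ t in Ioi (0 : ℝ), S.content K μ α s {x ∈ K | ENNReal.ofReal t < g x} := by
  have hdisj : Pairwise (Function.onFun Disjoint fun k : ℤ => Ioc (l ^ (k - 1)) (l ^ k)) :=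
    (zpow_right_mono₀ hl.le).pairwise_disjoint_on_Ioc_pred
  calc _ ≤ ∑' k : ℤ, ∫⁻ t in Ioc (l ^ (k - 1)) (l ^ k),
        S.content K μ α s {x ∈ K | ENNReal.ofReal t < g x} := by
        refine ENNReal.tsum_le_tsum fun k => ?_
        rw [mul_comm, ← Real.volume_Ioc, ← setLIntegral_const]
        refine setLIntegral_mono' measurableSet_Ioc fun t ht => content_mono μ α s ?_
        rintro x ⟨hx, hxt⟩
        exact ⟨hx, (ENNReal.ofReal_le_ofReal ht.2).trans_lt hxt⟩
    _ = ∫⁻ t in ⋃ k : ℤ, Ioc (l ^ (k - 1)) (l ^ k),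
        S.content K μ α s {x ∈ K | ENNReal.ofReal t < g x} :=
        (lintegral_iUnion (fun _ => measurableSet_Ioc) hdisj _).symm
    _ ≤ _ := by
        refine lintegral_mono_set (iUnion_subset fun k t ht => ?_)
        exact (zpow_pos (zero_lt_one.trans hl) _).trans ht.1

/-! ### The strong-type bound for exponents at most 1. -/

/-- If `g` is dominated by a combination of indicators of cubes, the Choquet integral of
`(M g)^p`, `p ≤ 1`, is controlled by the cost of that combination. -/
theorem lintegral_content_emaximalFunction_rpow_le_tsum (hK : S.IsSelfSimilarSet K)
    (hsep : S.StrongSeparation K) (μ : Measure (EuclideanSpace ℝ (Fin d))) [IsFiniteMeasure μ]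
    {α s p : ℝ} (hθ : 0 < α / s) (hp : α / s < p) (hp1 : p ≤ 1) {ι : Type*} [Countable ι]
    (u : ι → List (Fin m)) (c : ι → ℝ≥0∞) (g : EuclideanSpace ℝ (Fin d) → ℝ≥0∞)
    (hg : ∀ x ∈ K, g x ≤ ∑' i, c i * (S.cube K (u i)).indicator 1 x) :
    ∫⁻ t in Ioi (0 : ℝ), S.content K μ α s
        {x ∈ K | ENNReal.ofReal t < S.emaximalFunction K μ g x ^ p} ≤
      ENNReal.ofReal (p / (p - α / s)) * ∑' i, c i ^ p * μ (S.cube K (u i)) ^ (α / s) := by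
  have hp0 : 0 < p := hθ.trans hp
  choose a ha1 ha2 using fun v => exists_weights_cube hK hsep μ hθ hp v
  refine (lintegral_content_le_tsum hK hsep μ α s (fun w => ∑' i, c i ^ p * a (u i) w) _
    fun x _ => ?_).trans ?_
  -- Taking p-th roots allows the supremum to be tested one cube at a time.
  · rw [← ENNReal.le_rpow_inv_iff hp0]
    refine iSup₂_le fun v hxv => ?_
    rw [ENNReal.le_rpow_inv_iff hp0]
    have havg : (∫⁻ y in S.cube K v, g y ∂μ) / μ (S.cube K v) ≤
        ∑' i, c i * (μ (S.cube K (u i) ∩ S.cube K v) / μ (S.cube K v)) := by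
      calc (∫⁻ y in S.cube K v, g y ∂μ) / μ (S.cube K v)
          ≤ (∫⁻ y in S.cube K v, ∑' i, c i * (S.cube K (u i)).indicator 1 y ∂μ) /
              μ (S.cube K v) := by
            gcongr ?_ / _
            exact setLIntegral_mono' (measurableSet_cube hK v) fun y hy =>
              hg y (cube_subset hK v hy)
        _ = (∑' i, c i * μ (S.cube K (u i) ∩ S.cube K v)) / μ (S.cube K v) := by
            have hmi : ∀ i, Measurable
                ((S.cube K (u i)).indicator (1 : EuclideanSpace ℝ (Fin d) → ℝ≥0∞)) :=
              fun i => measurable_one.indicator (measurableSet_cube hK (u i))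
            rw [lintegral_tsum fun i => ((hmi i).const_mul _).aemeasurable]
            congr 2 with i
            rw [lintegral_const_mul _ (hmi i), lintegral_indicator_one (measurableSet_cube hK _),
              Measure.restrict_apply (measurableSet_cube hK _)]
        _ = _ := by
            simp_rw [div_eq_mul_inv, ← mul_assoc]
            rw [ENNReal.tsum_mul_right]
    calc ((∫⁻ y in S.cube K v, g y ∂μ) / μ (S.cube K v)) ^ p
        ≤ (∑' i, c i * (μ (S.cube K (u i) ∩ S.cube K v) / μ (S.cube K v))) ^ p := by gcongr
      _ ≤ ∑' i, (c i * (μ (S.cube K (u i) ∩ S.cube K v) / μ (S.cube K v))) ^ p :=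
          ENNReal.tsum_rpow_le_tsum _ hp0 hp1
      _ ≤ ∑' i, c i ^ p * ∑' w, a (u i) w * (S.cube K w).indicator 1 x := by
          refine ENNReal.tsum_le_tsum fun i => ?_
          rw [ENNReal.mul_rpow_of_nonneg _ _ hp0.le]
          gcongr
          exact ha1 (u i) x v hxv
      _ = _ := by
          simp_rw [← ENNReal.tsum_mul_left, ← ENNReal.tsum_mul_right, mul_assoc]
          exact ENNReal.tsum_comm
  · calc ∑' w, (∑' i, c i ^ p * a (u i) w) * μ (S.cube K w) ^ (α / s)
        = ∑' i, c i ^ p * ∑' w, a (u i) w * μ (S.cube K w) ^ (α / s) := by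
          simp_rw [← ENNReal.tsum_mul_left, ← ENNReal.tsum_mul_right, mul_assoc]
          exact ENNReal.tsum_comm
      _ ≤ ∑' i, c i ^ p * (ENNReal.ofReal (p / (p - α / s)) * μ (S.cube K (u i)) ^ (α / s)) := by
          gcongr with i
          exact ha2 (u i)
      _ = _ := by
          rw [← ENNReal.tsum_mul_left]
          exact tsum_congr fun i => mul_left_comm _ _ _

theorem lintegral_content_emaximalFunction_rpow_le (hK : S.IsSelfSimilarSet K)
    (hsep : S.StrongSeparation K) (μ : Measure (EuclideanSpace ℝ (Fin d))) [IsFiniteMeasure μ]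
    {α s p : ℝ} (hθ : 0 < α / s) (hp : α / s < p) (hp1 : p ≤ 1)
    (g : EuclideanSpace ℝ (Fin d) → ℝ≥0∞) (hg : ∀ x, g x ≠ ∞) :
    ∫⁻ t in Ioi (0 : ℝ), S.content K μ α s
        {x ∈ K | ENNReal.ofReal t < S.emaximalFunction K μ g x ^ p} ≤
      ENNReal.ofReal (2 ^ (p + 2) / (p - α / s)) *
        ∫⁻ t in Ioi (0 : ℝ), S.content K μ α s {x ∈ K | ENNReal.ofReal t < g x ^ p} := by
  classical
  have hp0 : 0 < p := hθ.trans hp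
  have hpθ : 0 < p - α / s := sub_pos.2 hp
  obtain ⟨l, hl⟩ : ∃ l : ℝ, l = 2 ^ p := ⟨_, rfl⟩
  have hl1 : 1 < l := hl ▸ Real.one_lt_rpow one_lt_two hp0
  have hl0 : 0 < l := zero_lt_one.trans hl1
  -- This fixes the constant: since 2^(p+2) = 4l, it amounts to p l^(k+1) ≤ 2^(p+2) (l^k - l^(k-1)).
  have hlp : l * p ≤ 4 * (l - 1) := by
    have h2 : l ≤ 2 := by
      rw [hl]; simpa using Real.rpow_le_rpow_of_exponent_le one_le_two hp1
    have h3 : 1 + p / 2 ≤ l := by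
      have := Real.add_one_le_exp (Real.log 2 * p)
      rw [← Real.rpow_def_of_pos two_pos, ← hl] at this
      nlinarith [Real.log_two_gt_d9]
    nlinarith
  set E : ℤ → Set (EuclideanSpace ℝ (Fin d)) := fun k =>
    {x ∈ K | ENNReal.ofReal (l ^ k) < g x ^ p} with hE
  set C : ℝ := p / (p - α / s) with hC
  have hC0 : 0 < C := div_pos hp0 hpθ
  refine ENNReal.le_of_forall_pos_le_add fun ε hε _ => ?_
  obtain ⟨ε', hε'0, hε'⟩ := ENNReal.exists_pos_sum_of_countable'
    (ENNReal.coe_ne_zero.2 hε.ne') ℤ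
  have hfac : ∀ k : ℤ, ENNReal.ofReal (C * l ^ (k + 1)) ≠ 0 := fun k =>
    (ENNReal.ofReal_pos.2 (mul_pos hC0 (zpow_pos hl0 _))).ne'
  -- The k-th cover will carry the factor C l^(k+1), so its excess is chosen to contribute exactly
  -- ε' k.
  choose W hEW hW using fun k : ℤ => exists_cover_le_content_add (S := S) μ hθ
    (sep_subset K fun x => ENNReal.ofReal (l ^ k) < g x ^ p)
    (ENNReal.div_pos (hε'0 k).ne' (ENNReal.ofReal_ne_top (r := C * l ^ (k + 1)))).ne'
  have hpow : ∀ k : ℤ, ENNReal.ofReal ((2 : ℝ) ^ (k + 1)) ^ p = ENNReal.ofReal (l ^ (k + 1)) := by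
    intro k
    rw [ENNReal.ofReal_rpow_of_pos (by positivity), hl, ← Real.rpow_intCast, ← Real.rpow_intCast,
      ← Real.rpow_mul two_pos.le, ← Real.rpow_mul two_pos.le, mul_comm]
  set c : ℤ × List (Fin m) → ℝ≥0∞ := fun i =>
    (W i.1).indicator (fun _ => ENNReal.ofReal ((2 : ℝ) ^ (i.1 + 1))) i.2 with hc
  have hdom : ∀ x ∈ K, g x ≤ ∑' i, c i * (S.cube K i.2).indicator 1 x := by
    intro x hx
    rcases eq_or_ne (g x) 0 with h0 | h0
    · simp [h0]
    have htop : g x ^ p ≠ ∞ := ENNReal.rpow_ne_top_of_nonneg hp0.le (hg x)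
    have hpos : g x ^ p ≠ 0 := by simp [ENNReal.rpow_eq_zero_iff, h0, hp0, hp0.le]
    -- Finiteness of g is what places a nonzero value of g^p in some (l^k, l^(k+1)], that is, g in
    -- (2^k, 2^(k+1)].
    obtain ⟨k, hk1, hk2⟩ := exists_mem_Ioc_zpow (ENNReal.toReal_pos hpos htop) hl1
    have hxE : x ∈ E k := ⟨hx, (ENNReal.ofReal_lt_iff_lt_toReal (by positivity) htop).2 hk1⟩
    obtain ⟨v, hv, hxv⟩ := mem_iUnion₂.1 (hEW k hxE)
    refine le_trans ?_ (ENNReal.le_tsum (k, v))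
    have : g x ≤ ENNReal.ofReal ((2 : ℝ) ^ (k + 1)) := by
      rw [← ENNReal.rpow_le_rpow_iff hp0, hpow]
      exact (ENNReal.le_ofReal_iff_toReal_le htop (by positivity)).2 hk2
    simpa [hc, hv, hxv] using this
  refine (lintegral_content_emaximalFunction_rpow_le_tsum hK hsep μ hθ hp hp1
    (fun i : ℤ × List (Fin m) => i.2) c g hdom).trans ?_
  calc ENNReal.ofReal C * ∑' i : ℤ × List (Fin m), c i ^ p * μ (S.cube K i.2) ^ (α / s)
      = ENNReal.ofReal C * ∑' k : ℤ, ENNReal.ofReal (l ^ (k + 1)) *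
          ∑' v : W k, μ (S.cube K (v : List (Fin m))) ^ (α / s) := by
        rw [ENNReal.tsum_prod']
        congr 2 with k
        rw [tsum_subtype (W k) (fun v => μ (S.cube K v) ^ (α / s)), ← ENNReal.tsum_mul_left]
        congr 1 with v
        by_cases hv : v ∈ W k
        · simp only [hc, indicator_of_mem hv, hpow]
        · simp [hc, indicator_of_notMem hv, hp0]
    _ = ∑' k : ℤ, ENNReal.ofReal (C * l ^ (k + 1)) *
          ∑' v : W k, μ (S.cube K (v : List (Fin m))) ^ (α / s) := by
        simp_rw [ENNReal.ofReal_mul hC0.le, mul_assoc]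
        rw [ENNReal.tsum_mul_left]
    _ ≤ ∑' k : ℤ, (ENNReal.ofReal (2 ^ (p + 2) / (p - α / s)) *
          (ENNReal.ofReal (l ^ k - l ^ (k - 1)) * S.content K μ α s (E k)) + ε' k) := by
        refine ENNReal.tsum_le_tsum fun k => ?_
        refine (mul_le_mul_right (hW k) _).trans ?_
        rw [mul_add, ENNReal.mul_div_cancel (hfac k) ENNReal.ofReal_ne_top, ← mul_assoc,
          ← ENNReal.ofReal_mul (by positivity)]
        gcongr ENNReal.ofReal ?_ * _ + _
        have e1 : l ^ (k + 1) = l ^ (k - 1) * l * l := by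
          rw [← zpow_add_one₀ hl0.ne', ← zpow_add_one₀ hl0.ne']; congr 1; ring
        have e2 : l ^ k = l ^ (k - 1) * l := by
          rw [← zpow_add_one₀ hl0.ne']; congr 1; ring
        have e3 : (2 : ℝ) ^ (p + 2) = l * 4 := by
          rw [Real.rpow_add two_pos, hl]; norm_num
        rw [e1, e2, e3, hC]
        have hfin : 0 ≤ l ^ (k - 1) * l / (p - α / s) := by positivity
        calc p / (p - α / s) * (l ^ (k - 1) * l * l)
            = l ^ (k - 1) * l / (p - α / s) * (l * p) := by ring
          _ ≤ l ^ (k - 1) * l / (p - α / s) * (4 * (l - 1)) := by gcongr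
          _ = _ := by ring
    _ ≤ _ := by
        rw [ENNReal.tsum_add, ENNReal.tsum_mul_left]
        gcongr
        exact tsum_zpow_content_le μ α s _ hl1

/-! ### Change of variables, Jensen's inequality and the conclusion. -/

/-- The substitution t ↦ t^p absorbs the weight p t^(p-1), leaving the unweighted integrals
estimated above. -/
theorem choquetPow_eq_lintegral (μ : Measure (EuclideanSpace ℝ (Fin d))) (α s : ℝ) {p : ℝ}
    (hp : 0 < p) (g : EuclideanSpace ℝ (Fin d) → ℝ≥0∞) :
    S.choquetPow K μ α s p g =
      ∫⁻ t in Ioi (0 : ℝ), S.content K μ α s {x ∈ K | ENNReal.ofReal t < g x ^ p} := by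
  have himg : (fun t : ℝ => t ^ p) '' Ioi 0 = Ioi 0 := by
    ext y
    constructor
    · rintro ⟨t, ht, rfl⟩
      exact Real.rpow_pos_of_pos ht p
    · intro hy
      exact ⟨y ^ p⁻¹, Real.rpow_pos_of_pos hy _, Real.rpow_inv_rpow (le_of_lt hy) hp.ne'⟩
  have hinj : InjOn (fun t : ℝ => t ^ p) (Ioi 0) := fun a ha b hb hab =>
    (Real.rpow_left_inj (le_of_lt ha) (le_of_lt hb) hp.ne').1 hab
  have hcv := lintegral_image_eq_lintegral_abs_deriv_mul (f' := fun t => p * t ^ (p - 1))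
    measurableSet_Ioi
    (fun t (ht : (0 : ℝ) < t) =>
      (Real.hasDerivAt_rpow_const (p := p) (Or.inl ht.ne')).hasDerivWithinAt) hinj
    (fun t => S.content K μ α s {x ∈ K | ENNReal.ofReal t < g x ^ p})
  rw [himg] at hcv
  rw [hcv, SimilitudeIFS.choquetPow, ← lintegral_const_mul' _ _ ENNReal.ofReal_ne_top]
  refine setLIntegral_congr_fun measurableSet_Ioi fun t (ht : 0 < t) => ?_
  have h0 : 0 < t ^ (p - 1) := Real.rpow_pos_of_pos ht _
  simp only [abs_of_pos (mul_pos hp h0), ENNReal.ofReal_mul hp.le,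
    ← ENNReal.ofReal_rpow_of_pos ht, ENNReal.rpow_lt_rpow_iff hp, mul_assoc]

/-- Hölder's inequality against the constant 1; on a null set both sides are 0 / 0 = 0. -/
theorem _root_.MeasureTheory.setLAverage_rpow_le {X : Type*} [MeasurableSpace X] (μ : Measure X)
    [IsFiniteMeasure μ] (A : Set X) {p : ℝ} (hp : 1 ≤ p) {g : X → ℝ≥0∞}
    (hg : AEMeasurable g (μ.restrict A)) :
    ((∫⁻ y in A, g y ∂μ) / μ A) ^ p ≤ (∫⁻ y in A, g y ^ p ∂μ) / μ A := by
  have hp0 : 0 < p := zero_lt_one.trans_le hp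
  rcases eq_or_ne (μ A) 0 with h0 | h0
  · simp [Measure.restrict_eq_zero.2 h0, hp0]
  have h := eLpNorm'_le_eLpNorm'_mul_rpow_measure_univ (f := g) zero_lt_one hp
    hg.aestronglyMeasurable
  simp only [eLpNorm', enorm_eq_self, ENNReal.rpow_one, one_div_one, Measure.restrict_apply_univ]
    at h
  have hA : μ A ≠ ∞ := measure_ne_top _ _
  calc ((∫⁻ y in A, g y ∂μ) / μ A) ^ p
      ≤ ((∫⁻ y in A, g y ^ p ∂μ) ^ (1 / p) * μ A ^ (1 - 1 / p) / μ A) ^ p := by gcongr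
    _ = ((∫⁻ y in A, g y ^ p ∂μ) ^ (1 / p) * μ A ^ (-(1 / p))) ^ p := by
        rw [mul_div_assoc, sub_eq_add_neg, add_comm, ENNReal.rpow_add _ _ h0 hA, ENNReal.rpow_one,
          ENNReal.mul_div_cancel_right h0 hA]
    _ = (∫⁻ y in A, g y ^ p ∂μ) / μ A := by
        rw [ENNReal.mul_rpow_of_nonneg _ _ hp0.le, ← ENNReal.rpow_mul, ← ENNReal.rpow_mul,
          neg_mul, one_div_mul_cancel hp0.ne', ENNReal.rpow_one, ENNReal.rpow_neg_one,
          div_eq_mul_inv]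

theorem emaximalFunction_rpow_le (hK : S.IsSelfSimilarSet K)
    (μ : Measure (EuclideanSpace ℝ (Fin d))) [IsFiniteMeasure μ] {p : ℝ} (hp : 1 ≤ p)
    {g : EuclideanSpace ℝ (Fin d) → ℝ≥0∞} (hg : AEMeasurable g (μ.restrict K))
    (x : EuclideanSpace ℝ (Fin d)) :
    S.emaximalFunction K μ g x ^ p ≤ S.emaximalFunction K μ (fun y => g y ^ p) x := by
  have hp0 : 0 < p := zero_lt_one.trans_le hp
  rw [← ENNReal.le_rpow_inv_iff hp0]
  refine iSup₂_le fun v hxv => ?_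
  rw [ENNReal.le_rpow_inv_iff hp0]
  exact (setLAverage_rpow_le μ _ hp
    (hg.mono_measure (Measure.restrict_mono (cube_subset hK v) le_rfl))).trans
    (le_iSup₂ (f := fun v (_ : x ∈ S.cube K v) =>
      (∫⁻ y in S.cube K v, g y ^ p ∂μ) / μ (S.cube K v)) v hxv)

end SimilitudeIFS

open SimilitudeIFS in
theorem theorem1p1 {d m : ℕ} (S : SimilitudeIFS d m)
    (K : Set (EuclideanSpace ℝ (Fin d))) (hK : S.IsSelfSimilarSet K)
    (hsep : S.StrongSeparation K)
    (w : Fin m → ℝ) (hw_nonneg : ∀ i, 0 ≤ w i) (hw_sum : ∑ i, w i = 1)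
    (μ : Measure (EuclideanSpace ℝ (Fin d))) (hμ : S.IsSelfSimilarMeasure w μ)
    (s : ℝ) (hs : s = (dimH K).toReal)
    (α p : ℝ) (hα : 0 < α) (hαs : α < s) (hp : α / s < p)
    (f : EuclideanSpace ℝ (Fin d) → ℝ) (hf : AEMeasurable f (μ.restrict K))
    (hf_fin : S.choquetPow K μ α s p (fun x => ENNReal.ofReal |f x|) < ∞) :
    S.choquetPow K μ α s p (S.maximalFunction K μ f) ≤
      ENNReal.ofReal (strongTypeConst p α s) *
        S.choquetPow K μ α s p (fun x => ENNReal.ofReal |f x|) := by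
  have : IsProbabilityMeasure μ := hμ.1
  have hs0 : 0 < s := hα.trans hαs
  have hθ : 0 < α / s := div_pos hα hs0
  have hθ1 : α / s < 1 := (div_lt_one hs0).2 hαs
  have hp0 : 0 < p := hθ.trans hp
  rw [choquetPow_eq_lintegral μ α s hp0, choquetPow_eq_lintegral μ α s hp0]
  -- `maximalFunction` of f is by definition `emaximalFunction` of |f|.
  change ∫⁻ t in Ioi (0 : ℝ), S.content K μ α s {x ∈ K | ENNReal.ofReal t <
    S.emaximalFunction K μ (fun y => ENNReal.ofReal |f y|) x ^ p} ≤ _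
  rcases lt_or_ge p 1 with hp1 | hp1
  · rw [strongTypeConst, if_pos hp1]
    exact lintegral_content_emaximalFunction_rpow_le hK hsep μ hθ hp hp1.le _
      fun _ => ENNReal.ofReal_ne_top
  · have hg : AEMeasurable (fun y => ENNReal.ofReal |f y|) (μ.restrict K) := by
      simpa only [Real.norm_eq_abs] using hf.norm.ennreal_ofReal
    have h1 := lintegral_content_emaximalFunction_rpow_le hK hsep μ hθ hθ1 le_rfl
      (fun y => ENNReal.ofReal |f y| ^ p)
      fun _ => ENNReal.rpow_ne_top_of_nonneg hp0.le ENNReal.ofReal_ne_top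
    simp only [ENNReal.rpow_one] at h1
    refine (lintegral_mono fun t => content_mono μ α s ?_).trans (h1.trans ?_)
    · rintro x ⟨hx, hxt⟩
      exact ⟨hx, hxt.trans_le (emaximalFunction_rpow_le hK μ hp1 hg x)⟩
    · rw [strongTypeConst, if_neg hp1.not_gt]
      gcongr ENNReal.ofReal ?_ * _
      have hθ' : 0 < 1 - α / s := sub_pos.2 hθ1
      rw [div_le_div_iff₀ hθ' (mul_pos hp0 hθ')]
      -- Exponent 1 gives 8/(1-θ), while 2^(2p+1) = 8·4^(p-1), so this is the inequality needed. It
      -- follows by squaring 2^(p-1) ≥ 1 + (p-1)/2.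
      have hb : p ≤ (4 : ℝ) ^ (p - 1) := by
        have h4 : (4 : ℝ) ^ (p - 1) = (2 ^ (p - 1)) ^ 2 := by
          rw [← Real.rpow_natCast, ← Real.rpow_mul two_pos.le, mul_comm, Real.rpow_mul two_pos.le]
          norm_num
        have h2 := Real.add_one_le_exp (Real.log 2 * (p - 1))
        rw [← Real.rpow_def_of_pos two_pos] at h2
        have h3 : 1 + (p - 1) / 2 ≤ (2 : ℝ) ^ (p - 1) := by nlinarith [Real.log_two_gt_d9]
        rw [h4]
        nlinarith
      have hpow : (2 : ℝ) ^ (2 * p + 1) = 8 * 4 ^ (p - 1) := by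
        rw [show 2 * p + 1 = 2 * (p - 1) + (3 : ℕ) by push_cast; ring, Real.rpow_add two_pos,
          Real.rpow_mul two_pos.le, Real.rpow_natCast]
        norm_num [mul_comm]
      have h8 : (2 : ℝ) ^ ((1 : ℝ) + 2) = 8 := by
        rw [show (1 : ℝ) + 2 = (3 : ℕ) by norm_num, Real.rpow_natCast]
        norm_num
      rw [hpow, h8]
      nlinarith
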